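/- For each positive integer $n$ let $V_1\subset\{1,\dots,n\}$ and $V_2=\{1,\dots,n\}\setminus V_1$ be two balanced communities, i.e. $|V_1|=n/2$ if $n$ is even and $|V_1|\in\{(n-1)/2,(n+1)/2\}$ if $n$ is odd. Let $0\le r_d\le r_s\le 1/2$ be real numbers that may depend on $n$, and let $X_1,\dots,X_n$ be independent random variables, uniform on $[0,1]$. The geometric block model $\mathcal G_n(r_s,r_d)$ is the random graph on $\{1,\dots,n\}$ with adjacency matrix $A$, where $A_{ii}=0$ and, for $i\ne j$, $A_{ij}=1$ if $$\min\{|X_i-X_j|,\,1-|X_i-X_j|\}\le \begin{cases} r_s & \text{if } i,j \text{ are in the same community},\\ r_d&\text{otherwise,}\end{cases}$$ and $A_{ij}=0$ otherwise. Let $d_i=\sum_j A_{ij}$ and let $$\overline{\mathcal C}_n=\frac1n\sum_{i=1}^n\frac{\sum_{j\neq k}A_{ij}A_{jk}A_{ki}}{d_i(d_i-1)}$$ be the average clustering coefficient, where terms with $d_i\in\{0,1\}$ are set to zero. Suppose that, as $n\to\infty$, $r_s=\Theta(r_d)$ and $nr_s\to\infty$, and that $r_s\le 1/3$ for all sufficiently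 large $n$. Then the following hold, where $o_P(1)$ denotes a sequence of random variables that converges to zero in probability. (I) If $r_d\le r_s<2r_d$ for all sufficiently large $n$, then $$\overline{\mathcal C}_n=\frac{3r_sr_d}{(r_s+r_d)^2}+o_P(1).$$ (II) If $r_s\ge 2r_d$ for all sufficiently large $n$, then $$\overline{\mathcal C}_n=\frac{3(r_s^2+4r_d^2)}{4(r_s+r_d)^2}+o_P(1).$$ -/

import Mathlib

open MeasureTheory ProbabilityTheory Filter Topology Asymptotics

noncomputable section

/-- The periodic distance `d(x, y) = min {|x - y|, 1 - |x - y|}` on the unit interval. -/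
def periodicDist (x y : ℝ) : ℝ := min |x - y| (1 - |x - y|)

open Classical in
/-- The connection threshold `r_d + (r_s - r_d) 𝕀[Z_i = Z_j]`. The two communities are `V₁` and its
complement, so `Z_i = Z_j` says that `i` and `j` are both in `V₁` or both outside it. -/
def gbmThreshold {n : ℕ} (rs rd : ℝ) (V₁ : Finset (Fin n)) (i j : Fin n) : ℝ :=
  rd + (rs - rd) * (if (i ∈ V₁ ↔ j ∈ V₁) then 1 else 0)

/-- The geometric block graph with node positions `x`: distinct nodes `i`, `j` are adjacent iff the
periodic distance of their positions is at most the threshold of the pair. With independent uniform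
positions this is the geometric block model. -/
def gbmGraph {n : ℕ} (rs rd : ℝ) (V₁ : Finset (Fin n)) (x : Fin n → ℝ) : SimpleGraph (Fin n) where
  Adj i j := i ≠ j ∧ periodicDist (x i) (x j) ≤ gbmThreshold rs rd V₁ i j
  symm := ⟨by
    intro i j h
    refine ⟨h.1.symm, ?_⟩
    have h2 := h.2
    simp only [periodicDist, gbmThreshold, abs_sub_comm (x j) (x i)] at h2 ⊢
    simpa only [iff_comm] using h2⟩
  loopless := ⟨fun _ h => h.1 rfl⟩

open Classical in
/-- The local clustering coefficient of node `i`: the sum over ordered pairs `j ≠ k` of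
`A_ij A_jk A_ki`, divided by `d_i (d_i - 1)`; it is set to zero if `d_i` is `0` or `1`. -/
def localClustering {n : ℕ} (G : SimpleGraph (Fin n)) (i : Fin n) : ℝ :=
  if 2 ≤ G.degree i then
    (∑ p ∈ (Finset.univ : Finset (Fin n)).offDiag,
      G.adjMatrix ℝ i p.1 * G.adjMatrix ℝ p.1 p.2 * G.adjMatrix ℝ p.2 i) /
      ((G.degree i : ℝ) * ((G.degree i : ℝ) - 1))
  else 0

/-- The average clustering coefficient. -/
def averageClustering {n : ℕ} (G : SimpleGraph (Fin n)) : ℝ :=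
  (1 / (n : ℝ)) * ∑ i, localClustering G i

/-- `Y_n = o_P(1)`: the random variables `Y_n`, each on its own probability space, converge to zero
in probability. -/
def IsLittleOP {Ω : ℕ → Type*} [∀ n, MeasurableSpace (Ω n)] (P : ∀ n, Measure (Ω n))
    (Y : ∀ n, Ω n → ℝ) : Prop :=
  ∀ ε : ℝ, 0 < ε → Tendsto (fun n => P n {ω | ε < |Y n ω|}) atTop (𝓝 0)

end

/-! Write `s`, `d` for the two radii. The local clustering coefficient of a node is N / Q, where N
counts ordered pairs of adjacent neighbours (triangles) and Q counts ordered pairs of distinct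
neighbours (wedges). Seen from that node, the other positions are independent and uniform on the
circle, so N and Q are sums over pairs of independent variables.

Balance gives E Q ≈ M = (n(s + d))². About n²/4 ordered pairs of leaves lie in the centre's own
community, each forming a triangle with probability 3s²; for the remaining 3n²/4 the triangle has
one within-community edge and two cross edges, and the probability is T = `clippedArea s d`. Hence E
N ≈ (3/4)n²(s² + T) = cM with c = 3(s² + T) / (4(s + d)²). The two regimes of the theorem are the
two branches of the maximum in T.

Pairs of leaves with no common index are uncorrelated, so both variances are bounded by the third
moment of a degree-like sum, of order (ns)³. The L¹ errors are therefore O((ns)^{3/2} + ns²),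
against M ≥ (ns)². Since 0 ≤ N ≤ Q, `abs_div_sub_le` transfers them to N / Q without any lower-tail
bound on Q. Averaging over the nodes needs only linearity of expectation, and Markov's inequality
concludes. -/

/-! ### Moments and concentration of sums over pairs of independent variables -/

theorem integral_sum_pow_three_le {ι E : Type*} [Fintype ι] [MeasurableSpace E]
    (ν : Measure E) [IsProbabilityMeasure ν] (a : ι → E → ℝ) (ha : ∀ i, Measurable (a i))
    (ha0 : ∀ i x, 0 ≤ a i x) (ha1 : ∀ i x, a i x ≤ 1) {m : ℝ} (hm : 1 ≤ m)
    (hsum : ∑ i, ∫ x, a i x ∂ν ≤ m) :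
    ∫ w, (∑ i, a i (w i)) ^ 3 ∂(Measure.pi fun _ : ι => ν) ≤ 54 * m ^ 3 := by
  have hm0 : 0 < m := by linarith
  -- Two facts give this: u³/3! ≤ eᵘ for u = (∑ a) / m, and eᵗ ≤ 1 + t + t² ≤ 1 + 2t on [0, 1],
  -- which applies to each term because m ≥ 1. The product then integrates factor by factor, to at
  -- most e² ≤ 9.
  have hpt : ∀ w : ι → E, (∑ i, a i (w i)) ^ 3 ≤ 6 * m ^ 3 * ∏ i, (1 + 2 / m * a i (w i)) := by
    intro w
    have hD : 0 ≤ ∑ i, a i (w i) := Finset.sum_nonneg fun i _ => ha0 i _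
    have h1 := Real.pow_div_factorial_le_exp ((∑ i, a i (w i)) / m) (by positivity) 3
    have h2 : Real.exp ((∑ i, a i (w i)) / m) ≤ ∏ i, (1 + 2 / m * a i (w i)) := by
      rw [Finset.sum_div, Real.exp_sum]
      refine Finset.prod_le_prod (fun i _ => (Real.exp_pos _).le) fun i _ => ?_
      have h0 : 0 ≤ a i (w i) / m := div_nonneg (ha0 _ _) hm0.le
      have h1 : a i (w i) / m ≤ 1 := by
        rw [div_le_one hm0]; exact (ha1 _ _).trans hm
      have h3 := Real.abs_exp_sub_one_sub_id_le (x := a i (w i) / m) (by rwa [abs_of_nonneg h0])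
      have h4 := (abs_le.1 h3).2
      have h5 : 2 / m * a i (w i) = 2 * (a i (w i) / m) := by ring
      rw [h5]
      nlinarith
    have h3 : (∑ i, a i (w i)) ^ 3 = 6 * m ^ 3 * (((∑ i, a i (w i)) / m) ^ 3 / (Nat.factorial 3 : ℕ)) := by
      simp only [Nat.factorial]; field_simp; norm_num
    rw [h3]
    exact mul_le_mul_of_nonneg_left (h1.trans h2) (by positivity)
  have hint : Integrable (fun w : ι → E => ∏ i, (1 + 2 / m * a i (w i)))
      (Measure.pi fun _ : ι => ν) := by
    refine Integrable.fintype_prod (f := fun i x => 1 + 2 / m * a i x) fun i => ?_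
    refine (integrable_const _).add (Integrable.const_mul ?_ _)
    exact Integrable.of_mem_Icc 0 1 (ha i).aemeasurable (ae_of_all _ fun x => ⟨ha0 i x, ha1 i x⟩)
  calc ∫ w, (∑ i, a i (w i)) ^ 3 ∂(Measure.pi fun _ : ι => ν)
      ≤ ∫ w, 6 * m ^ 3 * ∏ i, (1 + 2 / m * a i (w i)) ∂(Measure.pi fun _ : ι => ν) := by
        refine integral_mono_of_nonneg (ae_of_all _ fun w => ?_) (hint.const_mul _) (ae_of_all _ hpt)
        exact pow_nonneg (Finset.sum_nonneg fun i _ => ha0 i _) 3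
    _ = 6 * m ^ 3 * ∏ i, (1 + 2 / m * ∫ x, a i x ∂ν) := by
        rw [integral_const_mul, integral_fintype_prod_eq_prod (fun i x => 1 + 2 / m * a i x)]
        congr 1
        refine Finset.prod_congr rfl fun i _ => ?_
        rw [integral_add (integrable_const _), integral_const_mul]
        · simp
        · exact (Integrable.of_mem_Icc 0 1 (ha i).aemeasurable
            (ae_of_all _ fun x => ⟨ha0 i x, ha1 i x⟩)).const_mul _
    _ ≤ 6 * m ^ 3 * 9 := by
        refine mul_le_mul_of_nonneg_left ?_ (by positivity)
        have hE : ∀ i, 0 ≤ ∫ x, a i x ∂ν := fun i => integral_nonneg (ha0 i)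
        calc ∏ i, (1 + 2 / m * ∫ x, a i x ∂ν) ≤ ∏ i, Real.exp (2 / m * ∫ x, a i x ∂ν) := by
              refine Finset.prod_le_prod (fun i _ => ?_) fun i _ => ?_
              · have := hE i; positivity
              · rw [add_comm]; exact Real.add_one_le_exp _
          _ = Real.exp (2 / m * ∑ i, ∫ x, a i x ∂ν) := by
              rw [← Real.exp_sum, Finset.mul_sum]
          _ ≤ Real.exp (1 + 1) := by
              refine Real.exp_le_exp.2 ?_
              rw [div_mul_eq_mul_div, div_le_iff₀ hm0]; linarith
          _ ≤ 9 := by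
              rw [Real.exp_add]
              nlinarith [Real.exp_one_lt_d9, Real.exp_pos 1]
    _ = 54 * m ^ 3 := by ring

open Classical in
/-- Pairs of ordered pairs with a common entry contribute at most `4 (∑ a)³`. -/
theorem sum_overlapping_pairs_le {ι : Type*} [Fintype ι] (a : ι → ℝ)
    (ha0 : ∀ i, 0 ≤ a i) (ha1 : ∀ i, a i ≤ 1) :
    ∑ p : ι × ι, ∑ q : ι × ι,
      (if p.1 ≠ q.1 ∧ p.1 ≠ q.2 ∧ p.2 ≠ q.1 ∧ p.2 ≠ q.2 then 0
        else a p.1 * a p.2 * (a q.1 * a q.2)) ≤ 4 * (∑ i, a i) ^ 3 := by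
  set D := ∑ i, a i with hDdef
  have hD : 0 ≤ D := Finset.sum_nonneg fun i _ => ha0 i
  have hsq : ∑ i, a i * a i ≤ D :=
    Finset.sum_le_sum fun i _ => mul_le_of_le_one_right (ha0 i) (ha1 i)
  -- An overlap is one of four coincidences of indices; each contributes (∑ a²)D² ≤ D³, as a² ≤ a.
  have hsplit : ∀ p q : ι × ι,
      (if p.1 ≠ q.1 ∧ p.1 ≠ q.2 ∧ p.2 ≠ q.1 ∧ p.2 ≠ q.2 then 0
        else a p.1 * a p.2 * (a q.1 * a q.2)) ≤
      (if p.1 = q.1 then a p.1 * a p.2 * (a q.1 * a q.2) else 0) +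
      (if p.1 = q.2 then a p.1 * a p.2 * (a q.1 * a q.2) else 0) +
      (if p.2 = q.1 then a p.1 * a p.2 * (a q.1 * a q.2) else 0) +
      (if p.2 = q.2 then a p.1 * a p.2 * (a q.1 * a q.2) else 0) := by
    intro p q
    have h : 0 ≤ a p.1 * a p.2 * (a q.1 * a q.2) :=
      mul_nonneg (mul_nonneg (ha0 _) (ha0 _)) (mul_nonneg (ha0 _) (ha0 _))
    generalize a p.1 * a p.2 * (a q.1 * a q.2) = t at h
    split_ifs <;> first | linarith | tauto
  refine (Finset.sum_le_sum fun p _ => Finset.sum_le_sum fun q _ => hsplit p q).trans ?_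
  have h1 : ∀ x c, ∑ l, ∑ o, (if c = l then x * (a l * a o) else 0) = x * (a c * D) := by
    intro x c
    rw [Finset.sum_eq_single c (fun b _ hb => by simp [hb.symm]) (by simp)]
    simp [hDdef, Finset.mul_sum]
  have h2 : ∀ x c, ∑ l, ∑ o, (if c = o then x * (a l * a o) else 0) = x * (a c * D) := by
    intro x c
    simp only [Finset.sum_ite_eq, Finset.mem_univ, if_true, hDdef, Finset.mul_sum]
    exact Finset.sum_congr rfl fun l _ => by ring
  simp only [Finset.sum_add_distrib, Fintype.sum_prod_type, h1, h2]
  have e1 : ∑ j, ∑ k, a j * a k * (a j * D) = (∑ j, a j * a j) * D * D := by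
    rw [Finset.sum_mul, Finset.sum_mul]
    refine Finset.sum_congr rfl fun j _ => ?_
    rw [Finset.sum_congr rfl fun k _ => show a j * a k * (a j * D) = a j * a j * D * a k by ring,
      ← Finset.mul_sum]
  have e2 : ∑ j, ∑ k, a j * a k * (a k * D) = (∑ j, a j * a j) * D * D := by
    rw [Finset.sum_comm, ← e1]
    exact Finset.sum_congr rfl fun k _ => Finset.sum_congr rfl fun l _ => by ring
  have key : (∑ j, a j * a j) * D * D ≤ D ^ 3 := by
    calc _ ≤ D * D * D := by gcongr
      _ = _ := by ring
  linarith [e1, e2, key]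

/-- A random variable with variance at most `t ^ 2` deviates from its mean by at most `t` in `L¹`. -/
theorem integral_abs_sub_integral_le {Ω : Type*} [MeasurableSpace Ω] {μ : Measure Ω}
    [IsProbabilityMeasure μ] {F : Ω → ℝ} (hF : MemLp F 2 μ) {t : ℝ} (ht : 0 < t)
    {K : ℝ} (hv : Var[F; μ] ≤ K * t ^ 2) : ∫ w, |F w - ∫ v, F v ∂μ| ∂μ ≤ (K + 1) / 2 * t := by
  have hL : MemLp (fun w => F w - ∫ v, F v ∂μ) 2 μ := hF.sub (memLp_const _)
  -- Pointwise AM-GM: |L| ≤ L²/(2t) + t/2.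
  have h1 : ∫ w, |F w - ∫ v, F v ∂μ| ∂μ
      ≤ ∫ w, (1 / (2 * t) * (F w - ∫ v, F v ∂μ) ^ 2 + t / 2) ∂μ := by
    refine integral_mono (hL.integrable (by norm_num)).abs
      ((hL.integrable_sq.const_mul _).add (integrable_const _)) fun w => ?_
    have h := sq_nonneg (|F w - ∫ v, F v ∂μ| - t)
    rw [sub_sq, sq_abs] at h
    simp only
    rw [one_div, inv_mul_eq_div, div_add' _ _ _ (by positivity), le_div_iff₀ (by positivity)]
    nlinarith
  refine h1.trans ?_
  rw [integral_add (hL.integrable_sq.const_mul _) (integrable_const _), integral_const_mul,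
    ← variance_eq_integral hF.aemeasurable]
  simp only [integral_const, probReal_univ, smul_eq_mul, one_mul]
  rw [one_div, inv_mul_eq_div, div_add' _ _ _ (by positivity), div_le_iff₀ (by positivity)]
  nlinarith

/-- Concentration of a sum over ordered pairs of functions of independent variables. -/
theorem integral_abs_pairSum_sub_le {ι E : Type*} [Fintype ι] [DecidableEq ι] [MeasurableSpace E]
    (ν : Measure E) [IsProbabilityMeasure ν] (a : ι → E → ℝ) (ha : ∀ i, Measurable (a i))
    (ha0 : ∀ i x, 0 ≤ a i x) (ha1 : ∀ i x, a i x ≤ 1) {m : ℝ} (hm : 1 ≤ m)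
    (hsum : ∑ i, ∫ x, a i x ∂ν ≤ m)
    (f : ι → ι → E × E → ℝ) (hf : ∀ i j, Measurable (f i j)) (hf0 : ∀ i j z, 0 ≤ f i j z)
    (hfa : ∀ i j z, f i j z ≤ a i z.1 * a j z.2) :
    ∫ w, |∑ p ∈ (Finset.univ : Finset ι).offDiag, f p.1 p.2 (w p.1, w p.2) -
        ∑ p ∈ (Finset.univ : Finset ι).offDiag, ∫ z, f p.1 p.2 z ∂(ν.prod ν)|
        ∂(Measure.pi fun _ : ι => ν) ≤ 109 * (m * √m) := by
  set μ := Measure.pi fun _ : ι => ν with hμ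
  let T : ι × ι → (ι → E) → ℝ := fun p w => f p.1 p.2 (w p.1, w p.2)
  have hTm : ∀ p, Measurable (T p) := fun p =>
    (hf p.1 p.2).comp ((measurable_pi_apply _).prodMk (measurable_pi_apply _))
  have hT0 : ∀ p w, 0 ≤ T p w := fun p w => hf0 _ _ _
  have hTa : ∀ p w, T p w ≤ a p.1 (w p.1) * a p.2 (w p.2) := fun p w => hfa _ _ _
  have hT1 : ∀ p w, T p w ≤ 1 := fun p w => (hTa p w).trans
    (mul_le_one₀ (ha1 _ _) (ha0 _ _) (ha1 _ _))
  have hTL : ∀ p, MemLp (T p) 2 μ := fun p =>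
    MemLp.of_bound (hTm p).aestronglyMeasurable 1 (ae_of_all _ fun w => by
      rw [Real.norm_eq_abs, abs_of_nonneg (hT0 _ _)]; exact hT1 _ _)
  have hind : iIndepFun (fun i (w : ι → E) => w i) μ :=
    iIndepFun_pi (X := fun _ => id) fun _ => aemeasurable_id
  have hmean : ∀ p ∈ (Finset.univ : Finset ι).offDiag,
      ∫ w, T p w ∂μ = ∫ z, f p.1 p.2 z ∂(ν.prod ν) := by
    intro p hp
    have hne : p.1 ≠ p.2 := by simpa using hp
    have h2 := (indepFun_iff_map_prod_eq_prod_map_map (measurable_pi_apply _).aemeasurable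
      (measurable_pi_apply _).aemeasurable).1 (hind.indepFun hne)
    rw [(measurePreserving_eval (fun _ : ι => ν) p.1).map_eq,
      (measurePreserving_eval (fun _ : ι => ν) p.2).map_eq] at h2
    rw [← h2, integral_map ((measurable_pi_apply _).prodMk (measurable_pi_apply _)).aemeasurable
      (hf _ _).aestronglyMeasurable]
  have hF : MemLp (fun w => ∑ p ∈ (Finset.univ : Finset ι).offDiag, T p w) 2 μ :=
    memLp_finsetSum _ fun p _ => hTL p
  have hFint : ∫ w, ∑ p ∈ (Finset.univ : Finset ι).offDiag, T p w ∂μ =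
      ∑ p ∈ (Finset.univ : Finset ι).offDiag, ∫ z, f p.1 p.2 z ∂(ν.prod ν) := by
    rw [integral_finsetSum _ fun p _ => (hTL p).integrable (by norm_num)]
    exact Finset.sum_congr rfl hmean
  have hm0 : 0 < m := by linarith
  have hvar : Var[fun w => ∑ p ∈ (Finset.univ : Finset ι).offDiag, T p w; μ] ≤
      216 * (m * √m) ^ 2 := by
    rw [variance_fun_sum' fun p _ => hTL p]
    let G : ι × ι → ι × ι → (ι → E) → ℝ := fun p q w =>
      if p.1 ≠ q.1 ∧ p.1 ≠ q.2 ∧ p.2 ≠ q.1 ∧ p.2 ≠ q.2 then 0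
        else a p.1 (w p.1) * a p.2 (w p.2) * (a q.1 (w q.1) * a q.2 (w q.2))
    have hG0 : ∀ p q w, 0 ≤ G p q w := by
      intro p q w
      simp only [G]
      split_ifs
      · exact le_rfl
      · exact mul_nonneg (mul_nonneg (ha0 _ _) (ha0 _ _)) (mul_nonneg (ha0 _ _) (ha0 _ _))
    have hcoord : ∀ i, Measurable fun w : ι → E => a i (w i) :=
      fun i => (ha i).comp (measurable_pi_apply i)
    have hGi : ∀ p q, Integrable (G p q) μ := by
      intro p q
      refine Integrable.of_mem_Icc 0 1 (Measurable.aemeasurable ?_)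
        (ae_of_all _ fun w => ⟨hG0 p q w, ?_⟩)
      · simp only [G]
        split_ifs
        · exact measurable_const
        · exact ((hcoord _).mul (hcoord _)).mul ((hcoord _).mul (hcoord _))
      · simp only [G]
        split_ifs
        · exact zero_le_one
        · exact mul_le_one₀ (mul_le_one₀ (ha1 _ _) (ha0 _ _) (ha1 _ _))
            (mul_nonneg (ha0 _ _) (ha0 _ _)) (mul_le_one₀ (ha1 _ _) (ha0 _ _) (ha1 _ _))
    -- Disjoint pairs are independent; otherwise the product of the means is nonnegative and can be
    -- dropped, leaving E[T p · T q].
    have hcov : ∀ p q, cov[T p, T q; μ] ≤ ∫ w, G p q w ∂μ := by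
      intro p q
      by_cases h : p.1 ≠ q.1 ∧ p.1 ≠ q.2 ∧ p.2 ≠ q.1 ∧ p.2 ≠ q.2
      · have hI : IndepFun (T p) (T q) μ :=
          (hind.indepFun_prodMk_prodMk (fun i => measurable_pi_apply i) p.1 p.2 q.1 q.2
            h.1 h.2.1 h.2.2.1 h.2.2.2).comp (hf p.1 p.2) (hf q.1 q.2)
        rw [hI.covariance_eq_zero (hTL p) (hTL q)]
        exact integral_nonneg (hG0 p q)
      · rw [covariance_eq_sub (hTL p) (hTL q)]
        have h1 : 0 ≤ (∫ w, T p w ∂μ) * ∫ w, T q w ∂μ :=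
          mul_nonneg (integral_nonneg (hT0 p)) (integral_nonneg (hT0 q))
        have h2 : ∫ w, (T p * T q) w ∂μ ≤ ∫ w, G p q w ∂μ := by
          refine integral_mono_of_nonneg (ae_of_all _ fun w => mul_nonneg (hT0 p w) (hT0 q w))
            (hGi p q) (ae_of_all _ fun w => ?_)
          simp only [G, if_neg h, Pi.mul_apply]
          exact mul_le_mul (hTa p w) (hTa q w) (hT0 q w) (mul_nonneg (ha0 _ _) (ha0 _ _))
        linarith
    have hGn : ∀ p q, 0 ≤ ∫ w, G p q w ∂μ := fun p q => integral_nonneg (hG0 p q)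
    calc ∑ p ∈ (Finset.univ : Finset ι).offDiag, ∑ q ∈ (Finset.univ : Finset ι).offDiag,
          cov[T p, T q; μ]
        ≤ ∑ p ∈ (Finset.univ : Finset ι).offDiag, ∑ q ∈ (Finset.univ : Finset ι).offDiag,
          ∫ w, G p q w ∂μ :=
          Finset.sum_le_sum fun p _ => Finset.sum_le_sum fun q _ => hcov p q
      _ ≤ ∑ p : ι × ι, ∑ q : ι × ι, ∫ w, G p q w ∂μ := by
          refine (Finset.sum_le_sum fun p _ => Finset.sum_le_sum_of_subset_of_nonneg
            (Finset.subset_univ _) fun q _ _ => hGn p q).trans ?_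
          exact Finset.sum_le_sum_of_subset_of_nonneg (Finset.subset_univ _)
            fun p _ _ => Finset.sum_nonneg fun q _ => hGn p q
      _ = ∫ w, ∑ p : ι × ι, ∑ q : ι × ι, G p q w ∂μ := by
          rw [integral_finsetSum _ fun p _ => integrable_finsetSum _ fun q _ => hGi p q]
          exact Finset.sum_congr rfl fun p _ => (integral_finsetSum _ fun q _ => hGi p q).symm
      _ ≤ ∫ w, 4 * (∑ i, a i (w i)) ^ 3 ∂μ := by
          refine integral_mono_of_nonneg (ae_of_all _ fun w => Finset.sum_nonneg fun p _ =>
            Finset.sum_nonneg fun q _ => hG0 p q w) ?_ (ae_of_all _ fun w => ?_)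
          · refine Integrable.const_mul (Integrable.of_mem_Icc 0 ((Fintype.card ι : ℝ) ^ 3)
              ((Finset.measurable_sum _ fun i _ => hcoord i).pow_const 3).aemeasurable
              (ae_of_all _ fun w => ⟨pow_nonneg (Finset.sum_nonneg fun i _ => ha0 i _) 3, ?_⟩)) _
            refine pow_le_pow_left₀ (Finset.sum_nonneg fun i _ => ha0 i _) ?_ 3
            refine (Finset.sum_le_sum fun i _ => ha1 i (w i)).trans ?_
            simp
          · convert! sum_overlapping_pairs_le (fun i => a i (w i)) (fun i => ha0 i _)
              (fun i => ha1 i _) using 6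
      _ ≤ 4 * (54 * m ^ 3) := by
          rw [integral_const_mul]
          exact mul_le_mul_of_nonneg_left (integral_sum_pow_three_le ν a ha ha0 ha1 hm hsum)
            (by norm_num)
      _ = 216 * (m * √m) ^ 2 := by
          rw [mul_pow, Real.sq_sqrt hm0.le]; ring
  -- Here K = 216 = 4 · 54, and (216 + 1)/2 ≤ 109.
  have := integral_abs_sub_integral_le hF (t := m * √m) (by positivity) hvar
  rw [hFint] at this
  refine this.trans ?_
  have : 0 ≤ m * √m := by positivity
  linarith

/-! ### Balls on the circle and the triangle integral -/

/-- The real-valued indicator of the closed ball of radius `r` around zero in the circle. -/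
noncomputable def circleBall (r : ℝ) (x : UnitAddCircle) : ℝ := if ‖x‖ ≤ r then 1 else 0

instance UnitAddCircle.isProbabilityMeasure_volume :
    IsProbabilityMeasure (volume : Measure UnitAddCircle) :=
  ⟨UnitAddCircle.measure_univ⟩

theorem circleBall_nonneg (r : ℝ) (x : UnitAddCircle) : 0 ≤ circleBall r x := by
  unfold circleBall; split_ifs <;> norm_num

theorem circleBall_le_one (r : ℝ) (x : UnitAddCircle) : circleBall r x ≤ 1 := by
  unfold circleBall; split_ifs <;> norm_num

theorem measurable_circleBall (r : ℝ) : Measurable (circleBall r) :=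
  Measurable.ite (measurableSet_le measurable_norm measurable_const) measurable_const
    measurable_const

theorem circleBall_sub_comm (r : ℝ) (x y : UnitAddCircle) :
    circleBall r (x - y) = circleBall r (y - x) := by
  simp only [circleBall, norm_sub_rev]

theorem integral_circleBall {r : ℝ} (h0 : 0 ≤ r) (h1 : r ≤ 1 / 2) :
    ∫ x, circleBall r x = 2 * r := by
  have : circleBall r = (Metric.closedBall (0 : UnitAddCircle) r).indicator 1 := by
    ext x
    simp [circleBall, Set.indicator]
  rw [this, integral_indicator_one Metric.isClosed_closedBall.measurableSet, Measure.real,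
    AddCircle.volume_closedBall, ENNReal.toReal_ofReal (by positivity), min_eq_right (by linarith)]

/-- Identifies the periodic distance of the model with the quotient norm; the endpoint |t| = 1 is
included since positions may be 0 and 1. -/
theorem UnitAddCircle.norm_coe_eq_min {t : ℝ} (ht : |t| ≤ 1) :
    ‖(t : UnitAddCircle)‖ = min |t| (1 - |t|) := by
  have h : ‖(t : UnitAddCircle)‖ = ‖((|t| : ℝ) : UnitAddCircle)‖ := by
    rcases abs_choice t with h | h <;> rw [h]
    rw [AddCircle.coe_neg, norm_neg]
  rw [h, UnitAddCircle.norm_eq, abs_sub_round_eq_min]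
  rcases ht.lt_or_eq with h1 | h1
  · rw [Int.fract_eq_self.2 ⟨abs_nonneg t, h1⟩]
  · simp [h1]

/-- The area of `{|x| ≤ d, |y| ≤ d, |x - y| ≤ s}` for `d ≤ s`. -/
noncomputable def clippedArea (s d : ℝ) : ℝ := 4 * d ^ 2 - max 0 (2 * d - s) ^ 2

theorem integral_min_sub {s d : ℝ} (h0 : 0 ≤ d) (hs : d ≤ s) :
    ∫ x in (0 : ℝ)..d, min d (s - x) = d ^ 2 - max 0 (2 * d - s) ^ 2 / 2 := by
  have hc : ∀ a b, IntervalIntegrable (fun x : ℝ => min d (s - x)) volume a b := fun a b =>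
    Continuous.intervalIntegrable (by fun_prop) a b
  rcases le_total (2 * d) s with h | h
  · rw [max_eq_left (by linarith), intervalIntegral.integral_congr (g := fun _ => d)]
    · simp; ring
    · intro x hx
      rw [Set.uIcc_of_le h0] at hx
      exact min_eq_left (by linarith [hx.2])
  · rw [max_eq_right (by linarith),
      ← intervalIntegral.integral_add_adjacent_intervals (hc 0 (s - d)) (hc (s - d) d),
      intervalIntegral.integral_congr (g := fun _ => d),
      intervalIntegral.integral_congr (a := s - d) (g := fun x => s - x)]
    · rw [intervalIntegral.integral_sub (by simp) (by simp)]
      simp; ring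
    · intro x hx
      rw [Set.uIcc_of_le (by linarith)] at hx
      exact min_eq_right (by linarith [hx.1])
    · intro x hx
      rw [Set.uIcc_of_le (by linarith)] at hx
      exact min_eq_left (by linarith [hx.2])

theorem integral_add_min_sub_abs {s d : ℝ} (h0 : 0 ≤ d) (hs : d ≤ s) :
    ∫ x in (-d)..d, (d + min d (s - |x|)) = clippedArea s d := by
  have hc : ∀ a b, IntervalIntegrable (fun x : ℝ => min d (s - |x|)) volume a b := fun a b =>
    Continuous.intervalIntegrable (by fun_prop) a b
  have h1 : ∫ x in (0 : ℝ)..d, min d (s - |x|) = d ^ 2 - max 0 (2 * d - s) ^ 2 / 2 := by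
    rw [← integral_min_sub h0 hs]
    refine intervalIntegral.integral_congr fun x hx => ?_
    rw [Set.uIcc_of_le h0] at hx
    simp only [abs_of_nonneg hx.1]
  have h2 : ∫ x in (-d)..0, min d (s - |x|) = ∫ x in (0 : ℝ)..d, min d (s - |x|) := by
    have := intervalIntegral.integral_comp_neg (a := -d) (b := 0) fun x => min d (s - |x|)
    simpa using this
  rw [intervalIntegral.integral_add (by simp) (hc _ _),
    ← intervalIntegral.integral_add_adjacent_intervals (hc (-d) 0) (hc 0 d), h2, h1, clippedArea]
  simp; ring

theorem integral_circle_eq_setIntegral (F : UnitAddCircle → ℝ) :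
    ∫ y, F y = ∫ y in Set.Ioc (-(1 / 2) : ℝ) (1 / 2), F y := by
  rw [← UnitAddCircle.integral_preimage (-(1 / 2)) F]
  norm_num

theorem norm_coe_eq_abs_of_mem {y : ℝ} (hy : y ∈ Set.Ioc (-(1 / 2) : ℝ) (1 / 2)) :
    ‖(y : UnitAddCircle)‖ = |y| := by
  have h : |y| ≤ 1 / 2 := abs_le.2 ⟨hy.1.le, hy.2⟩
  rw [UnitAddCircle.norm_coe_eq_min (by linarith), min_eq_left (by linarith)]

/-- The last two hypotheses keep the two arcs from meeting again around the back of the circle, so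
they intersect like the real intervals [-b, b] and [x - g, x + g]. -/
theorem integral_circleBall_mul_circleBall_sub {b g x : ℝ} (hb0 : 0 ≤ b) (hb : b ≤ 1 / 2)
    (hg0 : 0 ≤ g) (hxb : |x| ≤ b) (hxg : |x| ≤ g) (hsum : x + b + g ≤ 1) (hsum' : b + g - 1 < x) :
    ∫ y : UnitAddCircle, circleBall b y * circleBall g (x - y) =
      min b (x + g) - max (-b) (x - g) := by
  obtain ⟨hx1, hx2⟩ := abs_le.1 hxb
  obtain ⟨hx3, hx4⟩ := abs_le.1 hxg
  have hae : ∀ᵐ y : ℝ, y ∈ Set.Ioc (-(1 / 2) : ℝ) (1 / 2) →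
      circleBall b y * circleBall g (x - y) =
        (Set.Icc (max (-b) (x - g)) (min b (x + g))).indicator 1 y := by
    -- If x + b + g = 1, the arcs also touch at y = -b from behind; this null set is discarded.
    have hne : ∀ᵐ y : ℝ, y ≠ -b := by simp [ae_iff]
    filter_upwards [hne] with y hy hmem
    rw [circleBall, norm_coe_eq_abs_of_mem hmem]
    by_cases h : |y| ≤ b
    · have hy1 : -b < y := lt_of_le_of_ne (abs_le.1 h).1 (Ne.symm hy)
      have hy2 := (abs_le.1 h).2
      have hlt : |x - y| < 1 - g := abs_lt.2 ⟨by linarith, by linarith⟩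
      have hn := UnitAddCircle.norm_coe_eq_min (t := x - y) (by linarith)
      rw [AddCircle.coe_sub] at hn
      have hiff : ‖(x : UnitAddCircle) - y‖ ≤ g ↔ x - g ≤ y ∧ y ≤ x + g := by
        rw [hn, min_le_iff, or_iff_left (by linarith), abs_le]
        constructor <;> rintro ⟨h1, h2⟩ <;> constructor <;> linarith
      simp only [circleBall, hiff, if_pos h, one_mul, Set.indicator, Set.mem_Icc, max_le_iff,
        le_min_iff, hy1.le, hy2, true_and, Pi.one_apply]
    · have hnot : y ∉ Set.Icc (max (-b) (x - g)) (min b (x + g)) := fun hm =>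
        h (abs_le.2 ⟨(le_max_left _ _).trans hm.1, hm.2.trans (min_le_left _ _)⟩)
      rw [if_neg h, zero_mul, Set.indicator_of_notMem hnot]
  rw [integral_circle_eq_setIntegral, setIntegral_congr_ae measurableSet_Ioc hae,
    ← integral_Icc_eq_integral_Ioc, setIntegral_indicator measurableSet_Icc,
    Set.inter_eq_right.2 (Set.Icc_subset_Icc ((by linarith : (-(1 / 2) : ℝ) ≤ -b).trans
      (le_max_left _ _)) ((min_le_left _ _).trans hb))]
  simp only [Pi.one_apply, integral_const, smul_eq_mul, mul_one, measureReal_restrict_apply_univ]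
  rw [Real.volume_real_Icc_of_le]
  exact max_le (le_min (by linarith) (by linarith)) (le_min (by linarith) (by linarith))

/-- For fixed |x| ≤ d the overlap in y has length d + min d (s - |x|), whichever of the two
remaining edges has radius s. Integrating over x gives the area. -/
theorem integral_circle_triple {s d b g : ℝ} (h0 : 0 ≤ d) (hds : d ≤ s) (hs : s ≤ 1 / 2)
    (hsum : 2 * d + s ≤ 1) (hbg : b = s ∧ g = d ∨ b = d ∧ g = s) :
    ∫ z : UnitAddCircle × UnitAddCircle, circleBall d z.1 * circleBall b z.2 *
      circleBall g (z.1 - z.2) ∂(volume.prod volume) = clippedArea s d := by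
  have hm1 : ∀ r, Measurable fun z : UnitAddCircle × UnitAddCircle => circleBall r z.1 :=
    fun r => (measurable_circleBall r).comp measurable_fst
  have hm2 : ∀ r, Measurable fun z : UnitAddCircle × UnitAddCircle => circleBall r z.2 :=
    fun r => (measurable_circleBall r).comp measurable_snd
  have hm3 : ∀ r, Measurable fun z : UnitAddCircle × UnitAddCircle => circleBall r (z.1 - z.2) :=
    fun r => (measurable_circleBall r).comp (measurable_fst.sub measurable_snd)
  have hint : Integrable (fun z : UnitAddCircle × UnitAddCircle =>
      circleBall d z.1 * circleBall b z.2 * circleBall g (z.1 - z.2)) (volume.prod volume) :=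
    Integrable.of_mem_Icc 0 1 (((hm1 _).mul (hm2 _)).mul (hm3 _)).aemeasurable
      (ae_of_all _ fun z => ⟨mul_nonneg (mul_nonneg (circleBall_nonneg _ _)
        (circleBall_nonneg _ _)) (circleBall_nonneg _ _), mul_le_one₀ (mul_le_one₀
        (circleBall_le_one _ _) (circleBall_nonneg _ _) (circleBall_le_one _ _))
        (circleBall_nonneg _ _) (circleBall_le_one _ _)⟩)
  rw [integral_prod _ hint]
  simp only [mul_assoc, integral_const_mul]
  have hb0 : d ≤ b := by rcases hbg with h | h <;> linarith [h.1, h.2]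
  have hg0 : d ≤ g := by rcases hbg with h | h <;> linarith [h.1, h.2]
  have hb : b ≤ 1 / 2 := by rcases hbg with h | h <;> linarith [h.1, h.2]
  have hbgs : b + g = s + d := by rcases hbg with h | h <;> linarith [h.1, h.2]
  have hae : ∀ᵐ x : ℝ, x ∈ Set.Ioc (-(1 / 2) : ℝ) (1 / 2) →
      circleBall d x * ∫ y : UnitAddCircle, circleBall b y * circleBall g (x - y) =
        (Set.Ioc (-d) d).indicator (fun x => d + min d (s - |x|)) x := by
    have hne : ∀ᵐ y : ℝ, y ≠ -d := by simp [ae_iff]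
    filter_upwards [hne] with x hx hmem
    rw [circleBall, norm_coe_eq_abs_of_mem hmem]
    by_cases h : |x| ≤ d
    · have hx1 : -d < x := lt_of_le_of_ne (abs_le.1 h).1 (Ne.symm hx)
      have hx2 := (abs_le.1 h).2
      rw [if_pos h, one_mul, Set.indicator_of_mem (show x ∈ Set.Ioc (-d) d from ⟨hx1, hx2⟩),
        integral_circleBall_mul_circleBall_sub (h0.trans hb0) hb (h0.trans hg0) (h.trans hb0)
          (h.trans hg0) (by linarith) (by linarith)]
      rcases hbg with ⟨rfl, rfl⟩ | ⟨rfl, rfl⟩ <;> rcases abs_cases x with ⟨h1, h2⟩ | ⟨h1, h2⟩ <;>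
        rw [h1] <;> simp only [min_def, max_def] <;> split_ifs <;> linarith
    · rw [if_neg h, zero_mul, Set.indicator_of_notMem fun hm => h (abs_le.2 ⟨hm.1.le, hm.2⟩)]
  rw [integral_circle_eq_setIntegral, setIntegral_congr_ae measurableSet_Ioc hae,
    setIntegral_indicator measurableSet_Ioc, Set.inter_eq_right.2 (Set.Ioc_subset_Ioc
      (by linarith) (by linarith)), ← intervalIntegral.integral_of_le (by linarith),
    integral_add_min_sub_abs h0 hds]

/-! ### Wedge and triangle counts of a random star -/

noncomputable section

/-- The connection radius from the centre of a star to the leaf `i`, where `S` is the set of leaves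
in the community of the centre. -/
def starRadius {ι : Type*} [DecidableEq ι] (S : Finset ι) (s d : ℝ) (i : ι) : ℝ :=
  if i ∈ S then s else d

/-- The connection radius between the leaves `i` and `j`. -/
def leafRadius {ι : Type*} [DecidableEq ι] (S : Finset ι) (s d : ℝ) (i j : ι) : ℝ :=
  if (i ∈ S ↔ j ∈ S) then s else d

/-- The number of ordered pairs of distinct neighbours of the centre, for leaves at `w`. -/
def wedgeSum {ι : Type*} [DecidableEq ι] [Fintype ι] (S : Finset ι) (s d : ℝ)
    (w : ι → UnitAddCircle) : ℝ :=
  ∑ p ∈ (Finset.univ : Finset ι).offDiag,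
    circleBall (starRadius S s d p.1) (w p.1) * circleBall (starRadius S s d p.2) (w p.2)

/-- The number of ordered pairs of adjacent neighbours of the centre, for leaves at `w`. -/
def triangleSum {ι : Type*} [DecidableEq ι] [Fintype ι] (S : Finset ι) (s d : ℝ)
    (w : ι → UnitAddCircle) : ℝ :=
  ∑ p ∈ (Finset.univ : Finset ι).offDiag,
    circleBall (starRadius S s d p.1) (w p.1) * circleBall (starRadius S s d p.2) (w p.2) *
      circleBall (leafRadius S s d p.1 p.2) (w p.1 - w p.2)

theorem sum_offDiag_mul {ι : Type*} [DecidableEq ι] [Fintype ι] (u : ι → ℝ) :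
    ∑ p ∈ (Finset.univ : Finset ι).offDiag, u p.1 * u p.2 = (∑ i, u i) ^ 2 - ∑ i, u i ^ 2 := by
  have h := Finset.sum_union (f := fun p : ι × ι => u p.1 * u p.2)
    (Finset.disjoint_diag_offDiag (Finset.univ : Finset ι))
  rw [Finset.diag_union_offDiag, Finset.sum_product, Finset.sum_diag] at h
  rw [sq, Finset.sum_mul_sum, h]
  simp [sq]

theorem measurable_circleBall_apply {ι : Type*} (r : ℝ) (i : ι) :
    Measurable fun w : ι → UnitAddCircle => circleBall r (w i) :=
  (measurable_circleBall r).comp (measurable_pi_apply i)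

theorem clippedArea_mem {s d : ℝ} (h0 : 0 ≤ d) (hds : d ≤ s) :
    0 ≤ clippedArea s d ∧ clippedArea s d ≤ 4 * s ^ 2 := by
  unfold clippedArea
  rcases max_cases 0 (2 * d - s) with ⟨h, _⟩ | ⟨h, _⟩ <;> rw [h] <;> constructor <;> nlinarith

section Star

variable {ι : Type*} [DecidableEq ι] {S : Finset ι} {s d : ℝ}

theorem starRadius_mem (h0 : 0 ≤ d) (hds : d ≤ s) (i : ι) :
    0 ≤ starRadius S s d i ∧ starRadius S s d i ≤ s := by
  unfold starRadius; split_ifs <;> constructor <;> linarith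

theorem integral_wedge (h0 : 0 ≤ d) (hds : d ≤ s) (hs : s ≤ 1 / 2) (i j : ι) :
    ∫ z : UnitAddCircle × UnitAddCircle, circleBall (starRadius S s d i) z.1 *
      circleBall (starRadius S s d j) z.2 ∂(volume.prod volume) =
      2 * starRadius S s d i * (2 * starRadius S s d j) := by
  rw [integral_prod_mul, integral_circleBall (starRadius_mem h0 hds i).1
      ((starRadius_mem h0 hds i).2.trans hs), integral_circleBall (starRadius_mem h0 hds j).1
      ((starRadius_mem h0 hds j).2.trans hs)]

/-- A triangle inside one community has radii s, s, s; any other has radii s, d, d. The bound s ≤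
1/3 rules out wrapping even for three edges of length s. The product of indicators makes the later
sum over pairs depend only on the size of `S`. -/
theorem integral_triangle (h0 : 0 ≤ d) (hds : d ≤ s) (hs : s ≤ 1 / 3) (i j : ι) :
    ∫ z : UnitAddCircle × UnitAddCircle, circleBall (starRadius S s d i) z.1 *
      circleBall (starRadius S s d j) z.2 * circleBall (leafRadius S s d i j) (z.1 - z.2)
      ∂(volume.prod volume) =
      clippedArea s d + (if i ∈ S then 1 else 0) * (if j ∈ S then 1 else 0) *
        (3 * s ^ 2 - clippedArea s d) := by
  have hss : clippedArea s s = 3 * s ^ 2 := by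
    rw [clippedArea, max_eq_right (by linarith)]; ring
  by_cases hi : i ∈ S <;> by_cases hj : j ∈ S <;>
    simp only [starRadius, leafRadius, hi, hj, if_true, if_false, iff_true, iff_false,
      not_true_eq_false, one_mul, mul_zero, zero_mul, add_zero,
      add_sub_cancel]
  · rw [← hss]
    exact integral_circle_triple (by linarith) le_rfl (by linarith) (by linarith) (by simp)
  -- The swap moves the leaf at radius d into the first coordinate, as `integral_circle_triple`
  -- requires.
  · rw [← integral_prod_swap]
    rw [← integral_circle_triple h0 hds (by linarith) (by linarith) (b := s) (g := d) (by simp)]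
    refine integral_congr_ae (ae_of_all _ fun z => ?_)
    simp only [Prod.fst_swap, Prod.snd_swap]
    rw [circleBall_sub_comm, mul_comm (circleBall s _)]
  · exact integral_circle_triple h0 hds (by linarith) (by linarith) (by simp)
  · exact integral_circle_triple h0 hds (by linarith) (by linarith) (by simp)

variable [Fintype ι]

theorem triangleSum_nonneg (w : ι → UnitAddCircle) : 0 ≤ triangleSum S s d w :=
  Finset.sum_nonneg fun _ _ => mul_nonneg (mul_nonneg (circleBall_nonneg _ _)
    (circleBall_nonneg _ _)) (circleBall_nonneg _ _)

theorem triangleSum_le_wedgeSum (w : ι → UnitAddCircle) :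
    triangleSum S s d w ≤ wedgeSum S s d w :=
  Finset.sum_le_sum fun _ _ => mul_le_of_le_one_right
    (mul_nonneg (circleBall_nonneg _ _) (circleBall_nonneg _ _)) (circleBall_le_one _ _)

theorem measurable_wedgeSum : Measurable (wedgeSum S s d) :=
  Finset.measurable_sum _ fun p _ =>
    (measurable_circleBall_apply _ p.1).mul (measurable_circleBall_apply _ p.2)

theorem measurable_triangleSum : Measurable (triangleSum S s d) :=
  Finset.measurable_sum _ fun p _ =>
    ((measurable_circleBall_apply _ p.1).mul (measurable_circleBall_apply _ p.2)).mul
      ((measurable_circleBall _).comp ((measurable_pi_apply p.1).sub (measurable_pi_apply p.2)))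

theorem wedgeSum_le (w : ι → UnitAddCircle) :
    wedgeSum S s d w ≤ ((Finset.univ : Finset ι).offDiag.card : ℝ) := by
  rw [← nsmul_one, ← Finset.sum_const]
  exact Finset.sum_le_sum fun _ _ => mul_le_one₀ (circleBall_le_one _ _)
    (circleBall_nonneg _ _) (circleBall_le_one _ _)

theorem integrable_wedgeSum :
    Integrable (wedgeSum S s d) (volume : Measure (ι → UnitAddCircle)) := by
  have : IsProbabilityMeasure (volume : Measure (ι → UnitAddCircle)) := by
    rw [volume_pi]; infer_instance
  exact Integrable.of_mem_Icc 0 _ measurable_wedgeSum.aemeasurable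
    (ae_of_all _ fun w => ⟨(triangleSum_nonneg w).trans (triangleSum_le_wedgeSum w),
      wedgeSum_le w⟩)

theorem integrable_triangleSum :
    Integrable (triangleSum S s d) (volume : Measure (ι → UnitAddCircle)) := by
  have : IsProbabilityMeasure (volume : Measure (ι → UnitAddCircle)) := by
    rw [volume_pi]; infer_instance
  exact Integrable.of_mem_Icc 0 _ measurable_triangleSum.aemeasurable
    (ae_of_all _ fun w => ⟨triangleSum_nonneg w, (triangleSum_le_wedgeSum w).trans (wedgeSum_le w)⟩)

theorem sum_integral_circleBall_le (h0 : 0 ≤ d) (hds : d ≤ s) (hs : s ≤ 1 / 2) {n : ℝ}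
    (hn : (Fintype.card ι : ℝ) ≤ n) :
    ∑ i, ∫ x, circleBall (starRadius S s d i) x ≤ 2 * (n * s) := by
  calc ∑ i, ∫ x, circleBall (starRadius S s d i) x ≤ ∑ _i : ι, 2 * s := by
        refine Finset.sum_le_sum fun i _ => ?_
        have := starRadius_mem (S := S) h0 hds i
        rw [integral_circleBall this.1 (by linarith)]
        linarith
    _ ≤ 2 * (n * s) := by
        rw [Finset.sum_const, nsmul_eq_mul, Finset.card_univ]
        nlinarith

theorem sum_starRadius : ∑ i, starRadius S s d i = S.card * s + (Fintype.card ι - S.card) * d := by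
  have h : ∀ i, starRadius S s d i = d + (if i ∈ S then 1 else 0) * (s - d) := by
    intro i; unfold starRadius; split_ifs <;> ring
  simp only [h, Finset.sum_add_distrib, ← Finset.sum_mul, Finset.sum_boole]
  simp
  ring

/-- Balance makes the expected degree n(s + d) + O(s); squaring costs O(ns²), as does removing the
diagonal. -/
theorem abs_sum_wedge_sub_le (h0 : 0 ≤ d) (hds : d ≤ s) {n : ℝ} (hn : 1 ≤ n)
    (hι : (Fintype.card ι : ℝ) = n - 1) (hS : |(S.card : ℝ) + 1 - n / 2| ≤ 1 / 2) :
    |∑ p ∈ (Finset.univ : Finset ι).offDiag,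
      2 * starRadius S s d p.1 * (2 * starRadius S s d p.2) - (n * (s + d)) ^ 2| ≤
        100 * (n * s ^ 2) := by
  rw [sum_offDiag_mul fun i => 2 * starRadius S s d i, ← Finset.mul_sum, sum_starRadius, hι]
  have h2 : ∑ i, (2 * starRadius S s d i) ^ 2 ≤ 4 * (n * s ^ 2) := by
    calc ∑ i, (2 * starRadius S s d i) ^ 2 ≤ ∑ _i : ι, 4 * s ^ 2 := by
          refine Finset.sum_le_sum fun i _ => ?_
          have := starRadius_mem (S := S) h0 hds i
          nlinarith
      _ ≤ 4 * (n * s ^ 2) := by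
          rw [Finset.sum_const, nsmul_eq_mul, Finset.card_univ, hι]
          nlinarith [sq_nonneg s]
  have h2' : 0 ≤ ∑ i, (2 * starRadius S s d i) ^ 2 := Finset.sum_nonneg fun i _ => sq_nonneg _
  generalize ∑ i, (2 * starRadius S s d i) ^ 2 = t at h2 h2'
  -- The -1 accounts for the centre, absent from `S`; e is the parity imbalance.
  obtain ⟨e, he⟩ : ∃ e : ℝ, (S.card : ℝ) = n / 2 - 1 + e := ⟨S.card - n / 2 + 1, by ring⟩
  rw [he] at hS ⊢
  have he' : |e| ≤ 1 / 2 := by convert hS using 2; ring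
  obtain ⟨h3, h4⟩ := abs_le.1 he'
  have hδ : |2 * (e - 1) * s - 2 * e * d| ≤ 4 * s := by
    rw [abs_le]; constructor <;> nlinarith
  obtain ⟨h5, h6⟩ := abs_le.1 hδ
  have hrw : (2 * ((n / 2 - 1 + e) * s + (n - 1 - (n / 2 - 1 + e)) * d)) ^ 2 - t -
      (n * (s + d)) ^ 2 = 2 * (n * (s + d)) * (2 * (e - 1) * s - 2 * e * d) +
      (2 * (e - 1) * s - 2 * e * d) ^ 2 - t := by ring
  rw [hrw]
  have hs0 : 0 ≤ s := h0.trans hds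
  have h7 : |2 * (n * (s + d)) * (2 * (e - 1) * s - 2 * e * d)| ≤ 4 * (n * s) * (4 * s) := by
    rw [abs_mul, abs_of_nonneg (by positivity : 0 ≤ 2 * (n * (s + d)))]
    exact mul_le_mul (by nlinarith) hδ (abs_nonneg _) (by positivity)
  have h8 : (2 * (e - 1) * s - 2 * e * d) ^ 2 ≤ (4 * s) ^ 2 := sq_le_sq' h5 h6
  obtain ⟨h9, h10⟩ := abs_le.1 h7
  have h11 : s ^ 2 ≤ n * s ^ 2 := le_mul_of_one_le_left (sq_nonneg s) hn
  rw [abs_le]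
  constructor <;> nlinarith [sq_nonneg (2 * (e - 1) * s - 2 * e * d)]

theorem abs_sum_triangle_sub_le (h0 : 0 ≤ d) (hds : d ≤ s) {n : ℝ} (hn : 1 ≤ n)
    (hι : (Fintype.card ι : ℝ) = n - 1) (hS : |(S.card : ℝ) + 1 - n / 2| ≤ 1 / 2) :
    |∑ p ∈ (Finset.univ : Finset ι).offDiag, (clippedArea s d +
      (if p.1 ∈ S then 1 else 0) * (if p.2 ∈ S then 1 else 0) * (3 * s ^ 2 - clippedArea s d)) -
        3 / 4 * n ^ 2 * (s ^ 2 + clippedArea s d)| ≤ 40 * (n * s ^ 2) := by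
  have h1 := sum_offDiag_mul (ι := ι) fun _ => 1
  have h2 := sum_offDiag_mul (ι := ι) fun i => if i ∈ S then 1 else 0
  simp only [mul_one, one_pow, Finset.sum_const, nsmul_eq_mul, Finset.card_univ, hι, ite_pow,
    Finset.sum_boole, zero_pow two_ne_zero, Finset.filter_mem_eq_inter, Finset.univ_inter] at h1 h2
  rw [Finset.sum_add_distrib, ← Finset.sum_mul, h2, Finset.sum_const, nsmul_eq_mul, h1]
  obtain ⟨hT0, hT1⟩ := clippedArea_mem h0 hds
  generalize clippedArea s d = T at hT0 hT1
  obtain ⟨e, he⟩ : ∃ e : ℝ, (S.card : ℝ) = n / 2 - 1 + e := ⟨S.card - n / 2 + 1, by ring⟩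
  rw [he] at hS ⊢
  have he' : |e| ≤ 1 / 2 := by convert hS using 2; ring
  obtain ⟨h3, h4⟩ := abs_le.1 he'
  have hrw : ((n - 1) ^ 2 - (n - 1)) * T + ((n / 2 - 1 + e) ^ 2 - (n / 2 - 1 + e)) *
      (3 * s ^ 2 - T) - 3 / 4 * n ^ 2 * (s ^ 2 + T) =
      -((3 * n - 2) * T) + (n * (e - 3 / 2) + ((e - 1) ^ 2 - (e - 1))) * (3 * s ^ 2 - T) := by ring
  rw [hrw]
  have h5 : |n * (e - 3 / 2) + ((e - 1) ^ 2 - (e - 1))| ≤ 6 * n := by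
    rw [abs_le]; constructor <;> nlinarith
  have h6 : |3 * s ^ 2 - T| ≤ 4 * s ^ 2 := by
    rw [abs_le]; constructor <;> nlinarith [sq_nonneg s]
  have h7 : |(n * (e - 3 / 2) + ((e - 1) ^ 2 - (e - 1))) * (3 * s ^ 2 - T)| ≤
      6 * n * (4 * s ^ 2) := by
    rw [abs_mul]
    exact mul_le_mul h5 h6 (abs_nonneg _) (by positivity)
  have h8 : 0 ≤ (3 * n - 2) * T := mul_nonneg (by linarith) hT0
  have h9 : (3 * n - 2) * T ≤ 3 * n * (4 * s ^ 2) :=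
    mul_le_mul (by linarith) hT1 hT0 (by positivity)
  obtain ⟨h10, h11⟩ := abs_le.1 h7
  have h12 : 0 ≤ n * s ^ 2 := by positivity
  rw [abs_le]
  constructor <;> nlinarith

theorem integral_abs_sub_add_le {Ω : Type*} [MeasurableSpace Ω] {μ : Measure Ω}
    [IsProbabilityMeasure μ] {F : Ω → ℝ} (hF : Integrable F μ) {a b A B : ℝ}
    (h : ∫ w, |F w - a| ∂μ ≤ A) (hab : |a - b| ≤ B) : ∫ w, |F w - b| ∂μ ≤ A + B := by
  have hFa : Integrable (fun w => |F w - a|) μ := (hF.sub (integrable_const a)).abs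
  calc ∫ w, |F w - b| ∂μ ≤ ∫ w, (|F w - a| + |a - b|) ∂μ :=
        integral_mono (hF.sub (integrable_const b)).abs (hFa.add (integrable_const _))
          fun w => abs_sub_le _ _ _
    _ = ∫ w, |F w - a| ∂μ + |a - b| := by
        rw [integral_add hFa (integrable_const _)]; simp
    _ ≤ A + B := add_le_add h hab

/-- The wedge and triangle counts of a random star are close to their limits in `L¹`. -/
theorem integral_abs_wedgeSum_triangleSum_le (h0 : 0 ≤ d) (hds : d ≤ s) (hs : s ≤ 1 / 3) {n : ℝ}
    (hn : 1 ≤ n) (hns : 1 ≤ n * s) (hι : (Fintype.card ι : ℝ) = n - 1)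
    (hS : |(S.card : ℝ) + 1 - n / 2| ≤ 1 / 2) :
    ∫ w, |wedgeSum S s d w - (n * (s + d)) ^ 2| ≤
        109 * (2 * (n * s) * √(2 * (n * s))) + 100 * (n * s ^ 2) ∧
    ∫ w, |triangleSum S s d w - 3 / 4 * n ^ 2 * (s ^ 2 + clippedArea s d)| ≤
        109 * (2 * (n * s) * √(2 * (n * s))) + 40 * (n * s ^ 2) := by
  have hsum := sum_integral_circleBall_le (S := S) h0 hds (by linarith) 
    (by linarith : (Fintype.card ι : ℝ) ≤ n)
  have : IsProbabilityMeasure (volume : Measure (ι → UnitAddCircle)) := by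
    rw [volume_pi]; infer_instance
  have hm1 : ∀ r, Measurable fun z : UnitAddCircle × UnitAddCircle => circleBall r z.1 :=
    fun r => (measurable_circleBall r).comp measurable_fst
  have hm2 : ∀ r, Measurable fun z : UnitAddCircle × UnitAddCircle => circleBall r z.2 :=
    fun r => (measurable_circleBall r).comp measurable_snd
  have hm3 : ∀ r, Measurable fun z : UnitAddCircle × UnitAddCircle => circleBall r (z.1 - z.2) :=
    fun r => (measurable_circleBall r).comp (measurable_fst.sub measurable_snd)
  constructor
  · refine integral_abs_sub_add_le integrable_wedgeSum ?_ (abs_sum_wedge_sub_le h0 hds hn hι hS)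
    have := integral_abs_pairSum_sub_le (volume : Measure UnitAddCircle)
      (fun i => circleBall (starRadius S s d i)) (fun i => measurable_circleBall _)
      (fun i => circleBall_nonneg _) (fun i => circleBall_le_one _) (by linarith) hsum
      (fun i j z => circleBall (starRadius S s d i) z.1 * circleBall (starRadius S s d j) z.2)
      (fun i j => (hm1 _).mul (hm2 _))
      (fun i j z => mul_nonneg (circleBall_nonneg _ _) (circleBall_nonneg _ _))
      (fun i j z => le_rfl)
    simp only [integral_wedge h0 hds (by linarith : s ≤ 1 / 2)] at this
    exact this
  · refine integral_abs_sub_add_le integrable_triangleSum ?_ (abs_sum_triangle_sub_le h0 hds hn hι hS)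
    have := integral_abs_pairSum_sub_le (volume : Measure UnitAddCircle)
      (fun i => circleBall (starRadius S s d i)) (fun i => measurable_circleBall _)
      (fun i => circleBall_nonneg _) (fun i => circleBall_le_one _) (by linarith) hsum
      (fun i j z => circleBall (starRadius S s d i) z.1 * circleBall (starRadius S s d j) z.2 *
        circleBall (leafRadius S s d i j) (z.1 - z.2))
      (fun i j => ((hm1 _).mul (hm2 _)).mul (hm3 _))
      (fun i j z => mul_nonneg (mul_nonneg (circleBall_nonneg _ _) (circleBall_nonneg _ _))
        (circleBall_nonneg _ _))
      (fun i j z => mul_le_of_le_one_right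
        (mul_nonneg (circleBall_nonneg _ _) (circleBall_nonneg _ _)) (circleBall_le_one _ _))
    simp only [integral_triangle h0 hds hs] at this
    exact this

end Star

end

/-! ### From the graph to the star -/

noncomputable section

open Classical in
theorem localClustering_eq_div {n : ℕ} (G : SimpleGraph (Fin n)) (i : Fin n) :
    localClustering G i =
      (∑ p ∈ (Finset.univ : Finset (Fin n)).offDiag,
        G.adjMatrix ℝ i p.1 * G.adjMatrix ℝ p.1 p.2 * G.adjMatrix ℝ p.2 i) /
      ∑ p ∈ (Finset.univ : Finset (Fin n)).offDiag, G.adjMatrix ℝ i p.1 * G.adjMatrix ℝ i p.2 := by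
  have hsum : ∑ j, G.adjMatrix ℝ i j = G.degree i := by
    simp [SimpleGraph.adjMatrix_apply, ← SimpleGraph.card_neighborFinset_eq_degree,
      SimpleGraph.neighborFinset_eq_filter]
  have hsq : ∀ j, G.adjMatrix ℝ i j ^ 2 = G.adjMatrix ℝ i j := by
    intro j
    rw [SimpleGraph.adjMatrix_apply]
    split_ifs <;> norm_num
  rw [sum_offDiag_mul (G.adjMatrix ℝ i), Finset.sum_congr rfl fun j _ => hsq j, hsum,
    show (G.degree i : ℝ) ^ 2 - G.degree i = G.degree i * ((G.degree i : ℝ) - 1) by ring]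
  unfold localClustering
  split_ifs with h
  · rfl
  -- Here d(d - 1) = 0, and division by zero gives the conventional value 0.
  · have h' : G.degree i = 0 ∨ G.degree i = 1 := by omega
    rcases h' with h' | h' <;> simp [h']

theorem sum_offDiag_eq_sum_offDiag_ne {α : Type*} [Fintype α] [DecidableEq α] (i : α)
    (g : α → α → ℝ) (h1 : ∀ k, g i k = 0) (h2 : ∀ j, g j i = 0) :
    ∑ p ∈ (Finset.univ : Finset α).offDiag, g p.1 p.2 =
      ∑ p ∈ (Finset.univ : Finset {j // j ≠ i}).offDiag, g p.1 p.2 := by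
  symm
  refine Finset.sum_of_injOn (fun p => (p.1.1, p.2.1)) ?_ ?_ ?_ fun _ _ => rfl
  · rintro ⟨a, b⟩ _ ⟨c, d⟩ _ h
    simp only [Prod.mk.injEq] at h
    exact Prod.ext (Subtype.ext h.1) (Subtype.ext h.2)
  · rintro ⟨a, b⟩ h
    simpa [Subtype.ext_iff] using h
  · rintro ⟨a, b⟩ h hn
    by_cases ha : a = i
    · simp [ha, h1]
    by_cases hb : b = i
    · simp [hb, h2]
    refine absurd ⟨(⟨a, ha⟩, ⟨b, hb⟩), ?_, rfl⟩ hn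
    simpa using h

/-- The other nodes in the community of `i`. -/
def ownCommunity {n : ℕ} (V : Finset (Fin n)) (i : Fin n) : Finset {j // j ≠ i} :=
  Finset.univ.filter fun j => (i ∈ V ↔ j.1 ∈ V)

/-- The positions of the other nodes relative to `i`. -/
def relativePositions {α : Type*} (i : α) : (α → UnitAddCircle) →+ ({j // j ≠ i} → UnitAddCircle)
    where
  toFun u j := u j - u i
  map_zero' := by ext j; simp
  map_add' u v := by ext j; simp only [Pi.add_apply]; abel

/-- A continuous surjective homomorphism of compact groups carries Haar probability to Haar
probability. This replaces conditioning on the position of the centre. -/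
theorem measurePreserving_relativePositions {α : Type*} [Fintype α] [DecidableEq α] (i : α) :
    MeasurePreserving (relativePositions i) volume volume := by
  have : IsProbabilityMeasure (volume : Measure (α → UnitAddCircle)) := by
    rw [volume_pi]; infer_instance
  have : IsProbabilityMeasure (volume : Measure ({j // j ≠ i} → UnitAddCircle)) := by
    rw [volume_pi]; infer_instance
  have : (volume : Measure (α → UnitAddCircle)).IsAddHaarMeasure := by
    rw [volume_pi]; infer_instance
  have : (volume : Measure ({j // j ≠ i} → UnitAddCircle)).IsAddHaarMeasure := by
    rw [volume_pi]; infer_instance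
  refine AddMonoidHom.measurePreserving (f := relativePositions i) ?_ ?_ (by simp)
  · exact continuous_pi fun j => (continuous_apply j.1).sub (continuous_apply i)
  · intro v
    refine ⟨fun j => if h : j ≠ i then v ⟨j, h⟩ else 0, ?_⟩
    ext j
    simp [relativePositions, j.2]

theorem card_ownCommunity {n : ℕ} {V : Finset (Fin n)}
    (hV : |(V.card : ℝ) - (n : ℝ) / 2| ≤ 1 / 2) (i : Fin n) :
    |((ownCommunity V i).card : ℝ) + 1 - (n : ℝ) / 2| ≤ 1 / 2 := by
  have h1 : (ownCommunity V i).card + 1 = (Finset.univ.filter fun j => (i ∈ V ↔ j ∈ V)).card := by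
    rw [← Finset.card_erase_add_one (a := i) (by simp), ownCommunity,
      ← Finset.card_map (Function.Embedding.subtype _)]
    congr 2
    ext j
    simp [and_comm]
  have h2 : ((ownCommunity V i).card : ℝ) + 1 =
      ((Finset.univ.filter fun j => (i ∈ V ↔ j ∈ V)).card : ℝ) := by exact_mod_cast h1
  rw [h2]
  by_cases hi : i ∈ V
  · simpa [hi] using hV
  · have h3 : (Finset.univ.filter fun j => (i ∈ V ↔ j ∈ V)) = Vᶜ := by
      ext j; simp [hi]
    have h4 : (V.card : ℝ) + (Vᶜ.card : ℝ) = n := by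
      exact_mod_cast (by simp)
    rw [h3, abs_sub_comm]
    convert hV using 2
    linarith

section Graph

variable {n : ℕ} {s d : ℝ} {V : Finset (Fin n)} {x : Fin n → ℝ}

theorem gbmGraph_adj_iff (hx : ∀ j, x j ∈ Set.Icc (0 : ℝ) 1) {j k : Fin n} (hjk : j ≠ k) :
    (gbmGraph s d V x).Adj j k ↔
      ‖((x j : UnitAddCircle) - x k)‖ ≤ if (j ∈ V ↔ k ∈ V) then s else d := by
  have h : |x j - x k| ≤ 1 := by
    have := hx j; have := hx k
    simp only [Set.mem_Icc] at *
    exact abs_le.2 ⟨by linarith, by linarith⟩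
  rw [← AddCircle.coe_sub, UnitAddCircle.norm_coe_eq_min h]
  simp only [gbmGraph, periodicDist, gbmThreshold, ne_eq, hjk, not_false_eq_true, true_and]
  split_ifs <;> simp

open Classical in
theorem adjMatrix_gbmGraph (hx : ∀ j, x j ∈ Set.Icc (0 : ℝ) 1) {j k : Fin n} (hjk : j ≠ k) :
    (gbmGraph s d V x).adjMatrix ℝ j k =
      circleBall (if (j ∈ V ↔ k ∈ V) then s else d) ((x j : UnitAddCircle) - x k) := by
  simp only [SimpleGraph.adjMatrix_apply, circleBall, gbmGraph_adj_iff hx hjk]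

theorem localClustering_gbmGraph (hx : ∀ j, x j ∈ Set.Icc (0 : ℝ) 1) (i : Fin n) :
    localClustering (gbmGraph s d V x) i =
      triangleSum (ownCommunity V i) s d (relativePositions i fun j => (x j : UnitAddCircle)) /
      wedgeSum (ownCommunity V i) s d (relativePositions i fun j => (x j : UnitAddCircle)) := by
  classical
  have hA : ∀ j : {j // j ≠ i}, (gbmGraph s d V x).adjMatrix ℝ i j =
      circleBall (starRadius (ownCommunity V i) s d j)
        (relativePositions i (fun j => (x j : UnitAddCircle)) j) := by
    intro j
    rw [adjMatrix_gbmGraph hx j.2.symm, circleBall_sub_comm]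
    simp [starRadius, ownCommunity, relativePositions]
  rw [localClustering_eq_div]
  congr 1
  · rw [sum_offDiag_eq_sum_offDiag_ne i fun j k => (gbmGraph s d V x).adjMatrix ℝ i j *
      (gbmGraph s d V x).adjMatrix ℝ j k * (gbmGraph s d V x).adjMatrix ℝ k i]
    · refine Finset.sum_congr rfl fun p hp => ?_
      have hne : p.1.1 ≠ p.2.1 := by simpa [Subtype.ext_iff] using hp
      rw [((gbmGraph s d V x).isSymm_adjMatrix (α := ℝ)).apply i p.2.1, hA, hA,
        adjMatrix_gbmGraph hx hne, mul_right_comm]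
      congr 2
      · simp only [leafRadius, ownCommunity, Finset.mem_filter, Finset.mem_univ, true_and]
        by_cases h : i ∈ V <;> simp [h, not_iff_not]
      · simp [relativePositions]
    · intro k; simp
    · intro k; simp
  · rw [sum_offDiag_eq_sum_offDiag_ne i fun j k => (gbmGraph s d V x).adjMatrix ℝ i j *
      (gbmGraph s d V x).adjMatrix ℝ i k]
    · exact Finset.sum_congr rfl fun p hp => by rw [hA, hA]
    · intro k; simp
    · intro k; simp

end Graph

/-- Follows from (N/Q - c)M = (N - cM) - (N/Q)(Q - M) and 0 ≤ N/Q ≤ 1. The identity survives Q = 0,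
where N = 0 too. -/
theorem abs_div_sub_le {N Q c M : ℝ} (hN : 0 ≤ N) (hNQ : N ≤ Q) (hM : 0 < M) :
    |N / Q - c| ≤ (|N - c * M| + |Q - M|) / M := by
  have hQ : 0 ≤ Q := hN.trans hNQ
  have h0 : 0 ≤ N / Q := div_nonneg hN hQ
  have h1 : N / Q ≤ 1 := div_le_one_of_le₀ hNQ hQ
  have h2 : N / Q * Q = N := by
    rcases hQ.eq_or_lt with h | h
    · rw [← h] at hNQ ⊢; rw [mul_zero]; exact le_antisymm hN hNQ
    · exact div_mul_cancel₀ _ h.ne'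
  rw [le_div_iff₀ hM]
  calc |N / Q - c| * M = |(N - c * M) - N / Q * (Q - M)| := by
        rw [← abs_of_pos hM, ← abs_mul, abs_of_pos hM]
        congr 1
        linear_combination h2
    _ ≤ |N - c * M| + |N / Q * (Q - M)| := abs_sub _ _
    _ ≤ |N - c * M| + |Q - M| := by
        rw [abs_mul, abs_of_nonneg h0]
        gcongr
        exact mul_le_of_le_one_left (abs_nonneg _) h1

end

/-! ### Uniform positions, averaging over nodes and the limit -/

theorem hasLaw_circle_of_isUniform {Ω : Type*} [MeasurableSpace Ω] {P : Measure Ω} {X : Ω → ℝ}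
    (hX : pdf.IsUniform X (Set.Icc (0 : ℝ) 1) P volume) :
    HasLaw (fun ω => (X ω : UnitAddCircle)) volume P := by
  have hm : AEMeasurable X P := hX.aemeasurable (by simp) (by simp)
  have hL : HasLaw X (volume.restrict (Set.Ioc (0 : ℝ) (0 + 1))) P := by
    refine ⟨hm, ?_⟩
    have h := hX
    unfold pdf.IsUniform at h
    rw [h, ProbabilityTheory.cond, zero_add, restrict_Ioc_eq_restrict_Icc]
    simp
  exact (UnitAddCircle.measurePreserving_mk 0).fun_comp_hasLaw hL

theorem ae_mem_Icc_of_isUniform {Ω : Type*} [MeasurableSpace Ω] {P : Measure Ω} {X : Ω → ℝ}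
    (hX : pdf.IsUniform X (Set.Icc (0 : ℝ) 1) P volume) : ∀ᵐ ω ∂P, X ω ∈ Set.Icc (0 : ℝ) 1 := by
  have hm : AEMeasurable X P := hX.aemeasurable (by simp) (by simp)
  rw [← ae_map_iff (p := fun x => x ∈ Set.Icc (0 : ℝ) 1) hm measurableSet_Icc]
  unfold pdf.IsUniform at hX
  rw [hX]
  exact ProbabilityTheory.ae_cond_mem measurableSet_Icc

/-- The `L¹` error of the local clustering coefficients in terms of `y = n r_s`. -/
noncomputable def clusteringError (y : ℝ) : ℝ := 872 / √y + 140 / y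

theorem tendsto_clusteringError : Tendsto clusteringError atTop (𝓝 0) := by
  have h1 : Tendsto (fun y : ℝ => 872 / √y) atTop (𝓝 0) :=
    Real.tendsto_sqrt_atTop.const_div_atTop 872
  have h2 : Tendsto (fun y : ℝ => 140 / y) atTop (𝓝 0) := tendsto_id.const_div_atTop 140
  simpa [clusteringError] using! h1.add h2

theorem star_error_le {n s d : ℝ} (h0 : 0 ≤ d) (hs : s ≤ 1 / 3) (hn : 1 ≤ n) (hns : 1 ≤ n * s) :
    (109 * (2 * (n * s) * √(2 * (n * s))) + 40 * (n * s ^ 2) +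
      (109 * (2 * (n * s) * √(2 * (n * s))) + 100 * (n * s ^ 2))) / (n * (s + d)) ^ 2 ≤
      clusteringError (n * s) := by
  have hs0 : 0 < s := by by_contra h; nlinarith
  have hy : 0 < n * s := by linarith
  have h2 : √(2 * (n * s)) ≤ 2 * √(n * s) := by
    rw [Real.sqrt_le_left (by positivity), mul_pow, Real.sq_sqrt hy.le]
    linarith
  have h3 : n * s ^ 2 ≤ n * s := by nlinarith
  have h4 : (n * s) ^ 2 ≤ (n * (s + d)) ^ 2 := by gcongr; linarith
  rw [div_le_iff₀ (by positivity)]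
  have hE : 0 ≤ clusteringError (n * s) := by unfold clusteringError; positivity
  refine le_trans ?_ (mul_le_mul_of_nonneg_left h4 hE)
  -- The constants are 872 = 2 · 109 · 2 · 2, the last factor from √(2y) ≤ 2√y, and 140 = 40 + 100.
  have h5 : clusteringError (n * s) * (n * s) ^ 2 = 872 * (n * s * √(n * s)) + 140 * (n * s) := by
    unfold clusteringError
    have h6 : n * s = √(n * s) ^ 2 := (Real.sq_sqrt hy.le).symm
    have h7 : 0 < √(n * s) := Real.sqrt_pos.2 hy
    generalize √(n * s) = r at h6 h7
    rw [h6]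
    field_simp
  rw [h5]
  have h8 : n * s * √(2 * (n * s)) ≤ n * s * (2 * √(n * s)) := by gcongr
  nlinarith

theorem measure_abs_averageClustering_sub_le {Ω : Type*} [MeasurableSpace Ω] (P : Measure Ω)
    [IsProbabilityMeasure P] {n : ℕ} (X : Fin n → Ω → ℝ) (hX_indep : iIndepFun X P)
    (hX_unif : ∀ i, pdf.IsUniform (X i) (Set.Icc (0 : ℝ) 1) P volume) (V : Finset (Fin n))
    (hV : |(V.card : ℝ) - (n : ℝ) / 2| ≤ 1 / 2) {s d : ℝ} (h0 : 0 ≤ d) (hds : d ≤ s)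
    (hs : s ≤ 1 / 3) (hns : 1 ≤ n * s) {ε : ℝ} (hε : 0 < ε) :
    P {ω | ε < |averageClustering (gbmGraph s d V fun i => X i ω) -
      3 * (s ^ 2 + clippedArea s d) / (4 * (s + d) ^ 2)|} ≤
      ENNReal.ofReal (clusteringError (n * s) / ε) := by
  have hs0 : 0 < s := by
    by_contra h
    have : (n : ℝ) * s ≤ 0 := mul_nonpos_of_nonneg_of_nonpos n.cast_nonneg (not_lt.1 h)
    linarith
  have hn0 : (0 : ℝ) < n := by
    by_contra h
    have : (n : ℝ) * s ≤ 0 := mul_nonpos_of_nonpos_of_nonneg (not_lt.1 h) hs0.le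
    linarith
  have hn : (1 : ℝ) ≤ n := by exact_mod_cast Nat.cast_pos.1 hn0
  set c := 3 * (s ^ 2 + clippedArea s d) / (4 * (s + d) ^ 2) with hc
  set M := ((n : ℝ) * (s + d)) ^ 2 with hM
  have hM0 : 0 < M := by positivity
  have hcM : c * M = 3 / 4 * (n : ℝ) ^ 2 * (s ^ 2 + clippedArea s d) := by
    have : s + d ≠ 0 := by positivity
    rw [hc, hM]; field_simp
  let U : Ω → Fin n → UnitAddCircle := fun ω j => (X j ω : UnitAddCircle)
  have hU : HasLaw U volume P := by
    rw [volume_pi]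
    exact iIndepFun.hasLaw_pi (fun j => hasLaw_circle_of_isUniform (hX_unif j))
      (hX_indep.comp (fun _ x => (x : UnitAddCircle)) fun _ => AddCircle.measurable_mk')
  have hW : ∀ i, HasLaw (fun ω => relativePositions i (U ω)) volume P := fun i =>
    (measurePreserving_relativePositions i).fun_comp_hasLaw hU
  let g : (i : Fin n) → ({j // j ≠ i} → UnitAddCircle) → ℝ := fun i w =>
    (|triangleSum (ownCommunity V i) s d w - c * M| + |wedgeSum (ownCommunity V i) s d w - M|) / M
  have hg0 : ∀ i w, 0 ≤ g i w := fun i w => by positivity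
  have hgi : ∀ i, Integrable (g i) volume ∧ ∫ w, g i w ≤ clusteringError (n * s) := by
    intro i
    have : IsProbabilityMeasure (volume : Measure ({j // j ≠ i} → UnitAddCircle)) := by
      rw [volume_pi]; infer_instance
    have hι : (Fintype.card {j // j ≠ i} : ℝ) = n - 1 := by
      have : Fintype.card {j // j ≠ i} = n - 1 := by simp
      rw [this, Nat.cast_sub (by exact_mod_cast hn), Nat.cast_one]
    obtain ⟨h1, h2⟩ := integral_abs_wedgeSum_triangleSum_le h0 hds hs hn hns hι
      (card_ownCommunity hV i)
    rw [← hcM] at h2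
    have hi1 := ((integrable_triangleSum (S := ownCommunity V i) (s := s) (d := d)).sub
      (integrable_const (c * M))).abs
    have hi2 := ((integrable_wedgeSum (S := ownCommunity V i) (s := s) (d := d)).sub
      (integrable_const M)).abs
    refine ⟨(hi1.add hi2).div_const M, ?_⟩
    refine le_trans ?_ (star_error_le h0 hs hn hns)
    simp only [g]
    rw [integral_div]
    refine div_le_div_of_nonneg_right ?_ hM0.le
    exact (integral_add hi1 hi2).trans_le (add_le_add h2 h1)
  -- An integrable majorant of the deviation, to which Markov's inequality applies; the summands may
  -- be dependent.
  let Z : Ω → ℝ := fun ω => 1 / (n : ℝ) * ∑ i, g i (relativePositions i (U ω))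
  have hgZ : ∀ i, Integrable (fun ω => g i (relativePositions i (U ω))) P := fun i => by
    have := (hgi i).1
    rw [← (hW i).map_eq] at this
    exact this.comp_aemeasurable (hW i).aemeasurable
  have hZ0 : ∀ ω, 0 ≤ Z ω := fun ω =>
    mul_nonneg (by positivity) (Finset.sum_nonneg fun i _ => hg0 i _)
  have hZi : Integrable Z P := (integrable_finsetSum _ fun i _ => hgZ i).const_mul _
  have hZ : ∫ ω, Z ω ∂P ≤ clusteringError (n * s) := by
    simp only [Z]
    rw [integral_const_mul, integral_finsetSum _ fun i _ => hgZ i, one_div, inv_mul_le_iff₀ hn0]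
    calc ∑ i, ∫ ω, g i (relativePositions i (U ω)) ∂P
        ≤ ∑ _i : Fin n, clusteringError (n * s) := Finset.sum_le_sum fun i _ => by
          have := (hW i).integral_comp (hgi i).1.aestronglyMeasurable
          exact this.trans_le (hgi i).2
      _ = n * clusteringError (n * s) := by simp
  have hae : ∀ᵐ ω ∂P, ∀ j, X j ω ∈ Set.Icc (0 : ℝ) 1 :=
    ae_all_iff.2 fun j => ae_mem_Icc_of_isUniform (hX_unif j)
  have hle : ∀ᵐ ω ∂P, |averageClustering (gbmGraph s d V fun i => X i ω) - c| ≤ Z ω := by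
    filter_upwards [hae] with ω hω
    have h1 : averageClustering (gbmGraph s d V fun i => X i ω) - c =
        1 / (n : ℝ) * ∑ i, (localClustering (gbmGraph s d V fun i => X i ω) i - c) := by
      rw [averageClustering, Finset.sum_sub_distrib, mul_sub]
      congr 1
      simp only [Finset.sum_const, Finset.card_univ, Fintype.card_fin, nsmul_eq_mul]
      field_simp
    rw [h1, abs_mul, abs_of_pos (by positivity : 0 < 1 / (n : ℝ))]
    refine mul_le_mul_of_nonneg_left ((Finset.abs_sum_le_sum_abs _ _).trans
      (Finset.sum_le_sum fun i _ => ?_)) (by positivity)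
    rw [localClustering_gbmGraph hω i]
    exact abs_div_sub_le (triangleSum_nonneg _) (triangleSum_le_wedgeSum _) hM0
  calc P {ω | ε < |averageClustering (gbmGraph s d V fun i => X i ω) - c|}
      ≤ P {ω | ε ≤ Z ω} := by
        refine measure_mono_ae ?_
        filter_upwards [hle] with ω hω h
        exact (le_of_lt h).trans hω
    _ = ENNReal.ofReal (P.real {ω | ε ≤ Z ω}) := (ENNReal.ofReal_toReal (measure_ne_top _ _)).symm
    _ ≤ ENNReal.ofReal (clusteringError (n * s) / ε) := by
        refine ENNReal.ofReal_le_ofReal ?_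
        rw [le_div_iff₀' hε]
        exact (mul_meas_ge_le_integral_of_nonneg (ae_of_all _ hZ0) hZi ε).trans hZ

theorem mainTheorem9
    {Ω : ℕ → Type*} [∀ n, MeasurableSpace (Ω n)]
    (P : ∀ n, Measure (Ω n)) [∀ n, IsProbabilityMeasure (P n)]
    (X : ∀ n, Fin n → Ω n → ℝ)
    (hX_indep : ∀ n, iIndepFun (X n) (P n))
    (hX_unif : ∀ n i, pdf.IsUniform (X n i) (Set.Icc (0 : ℝ) 1) (P n) volume)
    (V₁ : ∀ n, Finset (Fin n))
    (hbalanced : ∀ n, |((V₁ n).card : ℝ) - (n : ℝ) / 2| ≤ 1 / 2)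
    (rs rd : ℕ → ℝ)
    (hrange : ∀ n, 0 ≤ rd n ∧ rd n ≤ rs n ∧ rs n ≤ 1 / 2)
    (hnowrap : ∀ᶠ n in atTop, rs n ≤ 1 / 3)
    (htheta : rs =Θ[atTop] rd)
    (homega : Tendsto (fun n : ℕ => (n : ℝ) * rs n) atTop atTop) :
    ((∀ᶠ n in atTop, rs n < 2 * rd n) →
      IsLittleOP P (fun n ω =>
        averageClustering (gbmGraph (rs n) (rd n) (V₁ n) (fun i => X n i ω)) -
          3 * rs n * rd n / (rs n + rd n) ^ 2)) ∧
    ((∀ᶠ n in atTop, 2 * rd n ≤ rs n) →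
      IsLittleOP P (fun n ω =>
        averageClustering (gbmGraph (rs n) (rd n) (V₁ n) (fun i => X n i ω)) -
          3 * (rs n ^ 2 + 4 * rd n ^ 2) / (4 * (rs n + rd n) ^ 2))) := by
  have key : ∀ c : ℕ → ℝ, (∀ᶠ n in atTop, c n =
      3 * (rs n ^ 2 + clippedArea (rs n) (rd n)) / (4 * (rs n + rd n) ^ 2)) →
      IsLittleOP P (fun n ω =>
        averageClustering (gbmGraph (rs n) (rd n) (V₁ n) (fun i => X n i ω)) - c n) := by
    intro c hc ε hε
    have hlim : Tendsto (fun n : ℕ => ENNReal.ofReal (clusteringError (n * rs n) / ε)) atTop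
        (𝓝 0) := by
      have h := ((tendsto_clusteringError.comp homega).div_const ε)
      rw [zero_div] at h
      simpa using! ENNReal.tendsto_ofReal h
    refine tendsto_of_tendsto_of_tendsto_of_le_of_le' tendsto_const_nhds hlim
      (Eventually.of_forall fun n => zero_le) ?_
    filter_upwards [hc, hnowrap, homega.eventually_ge_atTop 1] with n hcn hn1 hn2
    simp only [hcn]
    exact measure_abs_averageClustering_sub_le (P n) (X n) (hX_indep n) (hX_unif n) (V₁ n)
      (hbalanced n) (hrange n).1 (hrange n).2.1 hn1 hn2 hε
  constructor
  · intro h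
    refine key _ ?_
    filter_upwards [h] with n hn
    -- With T = 4d² - (2d - s)² = 4sd - s², the numerator 3(s² + T) becomes 12sd.
    rw [clippedArea, max_eq_right (by linarith)]
    have h2 : 0 < rs n + rd n := by have := hrange n; linarith [this.1, this.2.1]
    field_simp
    ring
  · intro h
    refine key _ ?_
    filter_upwards [h] with n hn
    rw [clippedArea, max_eq_left (by linarith)]
    ring
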